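/- Let $K\ge 2$ be an integer, let $d\ge 1$, and let $\lambda=(\lambda_1,\dots,\lambda_d)$ be a probability vector ($\lambda_i\ge 0$, $\sum_i\lambda_i=1$). Let $|ij\rangle$, $1\le i,j\le d$, be the product basis of $\mathbb{C}^d\otimes\mathbb{C}^d$, and let $X\mapsto X^\Gamma$ be the partial transpose, that is, the linear map with $(|ij\rangle\langle kl|)^\Gamma=|il\rangle\langle kj|$. Put $$\sigma_{ii}=|ii\rangle\langle ii|,\qquad \sigma_{ij}=\tfrac12(|ij\rangle+|ji\rangle)(\langle ij|+\langle ji|)\ (i\neq j),\qquad \alpha_{ij}=\tfrac12(|ij\rangle-|ji\rangle)(\langle ij|-\langle ji|),$$ and let $S_{1/2}(\lambda)=2\log_2\sum_i\sqrt{\lambda_i}$ be the Rényi entropy of order $1/2$. Let $T(K;\lambda)$ be the optimal value of the semidefinite program $$T(K;\lambda)=\min\Big\{\sum_{i\ge j}s_{ij}+\sum_{i>j}a_{ij}\ \Big|\ s_{ij}\ge\frac{\sqrt{\lambda_i\lambda_j}}{K+1},\ a_{ij}\ge\frac{\sqrt{\lambda_i\lambda_j}}{K-1},\ \sum_{i\ge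 j}s_{ij}\sigma_{ij}^\Gamma+\sum_{i>j}a_{ij}\alpha_{ij}^\Gamma\ge 0\Big\}$$ in the $d^2$ real variables $s_{ij}$ ($i\ge j$) and $a_{ij}$ ($i>j$), where $\ge 0$ for an operator means positive semidefinite. Then this minimum is attained, and $$T(K;\lambda)=\max\left\{\frac{K2^{S_{1/2}(\lambda)}-1}{K^2-1}-\left(\sum_{i\ge j}\frac{\mu_{ij}\sqrt{\lambda_i\lambda_j}}{K+1}+\sum_{i>j}\frac{t_{ij}\sqrt{\lambda_i\lambda_j}}{K-1}\right)\ \middle|\ (\mu,t)\in R\right\},$$ where the maximum is attained and $$R=\Big\{(\mu,t)\ \Big|\ \mu_{ij}\le 1,\ t_{ij}\le 1,\ \sum_{i\ge j}\mu_{ij}\sigma_{ij}^\Gamma+\sum_{i>j}t_{ij}\alpha_{ij}^\Gamma\ge 0\Big\}$$ is a set of points with $d^2$ real coordinates $\mu_{ij}$ ($i\ge j$) and $t_{ij}$ ($i>j$). -/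

import Mathlib

open scoped ComplexOrder

namespace PPTDual

noncomputable section

/-- Linear operators on `ℂ^d ⊗ ℂ^d`, as matrices in the product basis `|ij⟩`. -/
abbrev Op (d : ℕ) : Type := Matrix (Fin d × Fin d) (Fin d × Fin d) ℂ

/-- The product basis vector `|ij⟩`. -/
def ket {d : ℕ} (i j : Fin d) : Fin d × Fin d → ℂ := Pi.single (i, j) 1

/-- The operator `|v⟩⟨v|`. -/
def outer {d : ℕ} (v : Fin d × Fin d → ℂ) : Op d := Matrix.vecMulVec v (star v)

/-- The partial transpose, the linear map with `|ij⟩⟨kl| ↦ |il⟩⟨kj|`. -/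
def partialTranspose {d : ℕ} (X : Op d) : Op d :=
  Matrix.of fun p q => X (p.1, q.2) (q.1, p.2)

/-- `σ_ij`, the projector onto `(|ij⟩ + |ji⟩)/√2` if `i ≠ j`, and onto `|ii⟩` if `i = j`. -/
def sigma {d : ℕ} (i j : Fin d) : Op d :=
  if i = j then outer (ket i i) else (1 / 2 : ℂ) • outer (ket i j + ket j i)

/-- `α_ij`, the projector onto `(|ij⟩ - |ji⟩)/√2` (for `i ≠ j`). -/
def alpha {d : ℕ} (i j : Fin d) : Op d :=
  (1 / 2 : ℂ) • outer (ket i j - ket j i)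

/-- The index pairs `(i, j)` with `i ≥ j`. -/
abbrev SymIdx (d : ℕ) : Type := {p : Fin d × Fin d // p.2 ≤ p.1}

/-- The index pairs `(i, j)` with `i > j`. -/
abbrev AltIdx (d : ℕ) : Type := {p : Fin d × Fin d // p.2 < p.1}

/-- The `d ^ 2` real variables of either program: one family indexed by the pairs `i ≥ j`
and one family indexed by the pairs `i > j`. -/
abbrev Vars (d : ℕ) : Type := (SymIdx d → ℝ) × (AltIdx d → ℝ)

/-- The operator `∑_{i ≥ j} x_ij σ_ij^Γ + ∑_{i > j} y_ij α_ij^Γ` for `v = (x, y)`. -/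
def pencil {d : ℕ} (v : Vars d) : Op d :=
  ∑ p : SymIdx d, (v.1 p : ℂ) • partialTranspose (sigma p.1.1 p.1.2) +
    ∑ p : AltIdx d, (v.2 p : ℂ) • partialTranspose (alpha p.1.1 p.1.2)

/-- Feasible points `(s, a)` of the primal semidefinite program. -/
def primalFeasible {d : ℕ} (K : ℕ) (lam : Fin d → ℝ) : Set (Vars d) :=
  {v | (∀ p : SymIdx d, Real.sqrt (lam p.1.1 * lam p.1.2) / ((K : ℝ) + 1) ≤ v.1 p) ∧
    (∀ p : AltIdx d, Real.sqrt (lam p.1.1 * lam p.1.2) / ((K : ℝ) - 1) ≤ v.2 p) ∧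
    (pencil v).PosSemidef}

/-- The primal objective `∑_{i ≥ j} s_ij + ∑_{i > j} a_ij`. -/
def primalObjective {d : ℕ} (v : Vars d) : ℝ :=
  ∑ p : SymIdx d, v.1 p + ∑ p : AltIdx d, v.2 p

/-- `T(K; λ)`, the optimal value of the primal semidefinite program. -/
def T {d : ℕ} (K : ℕ) (lam : Fin d → ℝ) : ℝ :=
  sInf (primalObjective '' primalFeasible K lam)

/-- The Rényi entropy `S_t(λ)` in base two, for `t` in `(0, 1) ∪ (1, ∞)`. -/
def renyiEntropy {d : ℕ} (t : ℝ) (lam : Fin d → ℝ) : ℝ :=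
  1 / (1 - t) * Real.logb 2 (∑ i, lam i ^ t)

/-- The set `R` of dual feasible points `(μ, t)`. -/
def dualFeasible (d : ℕ) : Set (Vars d) :=
  {v | (∀ p : SymIdx d, v.1 p ≤ 1) ∧ (∀ p : AltIdx d, v.2 p ≤ 1) ∧ (pencil v).PosSemidef}

/-- The dual objective. -/
def dualObjective {d : ℕ} (K : ℕ) (lam : Fin d → ℝ) (v : Vars d) : ℝ :=
  ((K : ℝ) * (2 : ℝ) ^ renyiEntropy (1 / 2) lam - 1) / ((K : ℝ) ^ 2 - 1) -
    (∑ p : SymIdx d, v.1 p * Real.sqrt (lam p.1.1 * lam p.1.2) / ((K : ℝ) + 1) +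
      ∑ p : AltIdx d, v.2 p * Real.sqrt (lam p.1.1 * lam p.1.2) / ((K : ℝ) - 1))

end

end PPTDual

open scoped ComplexOrder

namespace PPTDual

/-! This is conic linear programming duality over a self-dual cone. The partial transpose makes the
pencil block diagonal: `|ij⟩` and `|ji⟩` carry the weight `(s_ij + a_ij)/2`, and the span of the
`|ii⟩` carries a real symmetric matrix with diagonal `s_ii` and off-diagonal entries `(s_ij -
a_ij)/2`. Hence the cone of positive pencils is a product of a cone of positive semidefinite
matrices and an orthant, and it is self-dual for `dot` (`dot_nonneg_of_mem_cone`,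
`mem_cone_of_dot_nonneg`).

With `c` the vector of lower bounds, the primal minimizes `1·v` over `v ≥ c` in the cone, and the
dual maximizes `1·c - c·w` over `w ≤ 1` in the cone. Weak duality combines `(1 - w)·(v - c) ≥ 0`
with `v·w ≥ 0`. For the converse, `exists_dual_or_primal` separates a point from `valueCone c`,
which is closed because cone elements bounded above are also bounded below. Closedness gives
attainment in the dual; compact sublevel sets give it in the primal. -/

/-! ### Sums over ordered index pairs -/

/-- The symmetric variable at the diagonal pair `(i, i)`. -/
abbrev diagIdx {d : ℕ} (i : Fin d) : SymIdx d := ⟨(i, i), le_rfl⟩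

/-- The index pair `i > j` as an index pair `i ≥ j`. -/
abbrev altToSym {d : ℕ} (p : AltIdx d) : SymIdx d := ⟨p.1, p.2.le⟩

theorem sum_symIdx {d : ℕ} {M : Type*} [AddCommMonoid M] (f : SymIdx d → M) :
    ∑ p, f p = ∑ i, f (diagIdx i) + ∑ p : AltIdx d, f (altToSym p) := by
  classical
  let e : Fin d ⊕ AltIdx d → SymIdx d := Sum.elim diagIdx altToSym
  have he : Function.Bijective e := by
    constructor
    · rintro (i | ⟨⟨i, j⟩, hp⟩) (k | ⟨⟨k, l⟩, hq⟩) h <;>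
        simp only [e, Sum.elim_inl, Sum.elim_inr, Subtype.mk.injEq, Prod.mk.injEq] at h ⊢
      · simp [h.1]
      · simp only at hq; exact absurd hq (by rw [← h.1, ← h.2]; exact lt_irrefl i)
      · simp only at hp; exact absurd hp (by rw [h.1, h.2]; exact lt_irrefl k)
      · simp [h.1, h.2]
    · rintro ⟨⟨i, j⟩, hp⟩
      rcases lt_or_eq_of_le hp with h | h
      · exact ⟨Sum.inr ⟨(i, j), h⟩, rfl⟩
      · simp only at h; subst h
        exact ⟨Sum.inl j, rfl⟩
  rw [← (Equiv.ofBijective e he).sum_comp, Fintype.sum_sum_type]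
  rfl

theorem sum_sum_eq_diag_add_alt {d : ℕ} (f : Fin d → Fin d → ℝ) :
    ∑ i, ∑ j, f i j = ∑ i, f i i + ∑ p : AltIdx d, (f p.1.1 p.1.2 + f p.1.2 p.1.1) := by
  have h2 : ∀ g : Fin d → Fin d → ℝ, ∑ p : AltIdx d, g p.1.1 p.1.2
      = ∑ i, ∑ j, if j < i then g i j else 0 := fun g => by
    rw [← Fintype.sum_prod_type', ← Finset.sum_filter]
    exact (Finset.sum_subtype _ (by simp) fun p : Fin d × Fin d => g p.1 p.2).symm
  have h3 : ∑ i, f i i = ∑ i, ∑ j, if j = i then f i j else 0 := by simp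
  rw [Finset.sum_add_distrib, h2, h2 fun i j => f j i,
    Finset.sum_comm (f := fun i j => if j < i then f j i else 0), h3, ← Finset.sum_add_distrib,
    ← Finset.sum_add_distrib]
  refine Finset.sum_congr rfl fun i _ => ?_
  rw [← Finset.sum_add_distrib, ← Finset.sum_add_distrib]
  refine Finset.sum_congr rfl fun j _ => ?_
  rcases lt_trichotomy j i with h | h | h
  · simp [h, h.ne, h.not_gt]
  · simp [h]
  · simp [h, h.ne', h.not_gt]

/-! ### The pairing of the variables -/

/-- The Euclidean inner product of two families of variables. -/
def dot {d : ℕ} (v w : Vars d) : ℝ :=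
  ∑ p : SymIdx d, v.1 p * w.1 p + ∑ p : AltIdx d, v.2 p * w.2 p

theorem dot_comm {d : ℕ} (v w : Vars d) : dot v w = dot w v := by
  simp only [dot, mul_comm]

theorem dot_add_left {d : ℕ} (u v w : Vars d) : dot (u + v) w = dot u w + dot v w := by
  simp only [dot, Prod.fst_add, Prod.snd_add, Pi.add_apply, add_mul, Finset.sum_add_distrib]
  ring

theorem dot_smul_left {d : ℕ} (t : ℝ) (v w : Vars d) : dot (t • v) w = t * dot v w := by
  simp only [dot, Prod.smul_fst, Prod.smul_snd, Pi.smul_apply, smul_eq_mul, mul_assoc, mul_add,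
    Finset.mul_sum]

theorem dot_sub_left {d : ℕ} (u v w : Vars d) : dot (u - v) w = dot u w - dot v w := by
  simp only [dot, Prod.fst_sub, Prod.snd_sub, Pi.sub_apply, sub_mul, Finset.sum_sub_distrib]
  ring

theorem dot_add_right {d : ℕ} (u v w : Vars d) : dot u (v + w) = dot u v + dot u w := by
  rw [dot_comm, dot_add_left, dot_comm v, dot_comm w]

theorem dot_smul_right {d : ℕ} (t : ℝ) (v w : Vars d) : dot v (t • w) = t * dot v w := by
  rw [dot_comm, dot_smul_left, dot_comm]

theorem dot_sub_right {d : ℕ} (u v w : Vars d) : dot u (v - w) = dot u v - dot u w := by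
  rw [dot_comm, dot_sub_left, dot_comm v, dot_comm w]

theorem dot_nonneg {d : ℕ} {v w : Vars d} (hv : 0 ≤ v) (hw : 0 ≤ w) : 0 ≤ dot v w :=
  add_nonneg (Finset.sum_nonneg fun p _ => mul_nonneg (hv.1 p) (hw.1 p))
    (Finset.sum_nonneg fun p _ => mul_nonneg (hv.2 p) (hw.2 p))

theorem continuous_dot {d : ℕ} (v : Vars d) : Continuous (dot v) := by
  unfold dot
  fun_prop

theorem primalObjective_eq_dot {d : ℕ} (v : Vars d) : primalObjective v = dot 1 v := by
  simp [primalObjective, dot]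

theorem exists_dot_eq {d : ℕ} (f : Vars d →ₗ[ℝ] ℝ) : ∃ y : Vars d, ∀ v, f v = dot y v := by
  refine ⟨(fun p => f (Pi.single p 1, 0), fun p => f (0, Pi.single p 1)), fun v => ?_⟩
  have h1 := (f ∘ₗ LinearMap.inl ℝ (SymIdx d → ℝ) (AltIdx d → ℝ)).pi_apply_eq_sum_univ v.1
  have h2 := (f ∘ₗ LinearMap.inr ℝ (SymIdx d → ℝ) (AltIdx d → ℝ)).pi_apply_eq_sum_univ v.2
  have hs {ι : Type} [DecidableEq ι] (i : ι) :
      (fun j => if i = j then (1 : ℝ) else 0) = Pi.single i 1 := by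
    ext j
    simp [Pi.single_apply, eq_comm]
  simp only [hs, LinearMap.comp_apply, LinearMap.inl_apply, LinearMap.inr_apply,
    smul_eq_mul] at h1 h2
  rw [show v = (v.1, 0) + (0, v.2) by simp, map_add, h1, h2]
  simp [dot, mul_comm]

/-! ### The quadratic form of the pencil -/

theorem partialTranspose_single {d : ℕ} (i j k l : Fin d) :
    partialTranspose (Matrix.single (i, j) (k, l) (1 : ℂ)) = Matrix.single (i, l) (k, j) 1 := by
  ext ⟨a, b⟩ ⟨a', b'⟩
  simp only [partialTranspose, Matrix.of_apply, Matrix.single_apply, Prod.mk.injEq]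
  congr 1
  exact propext ⟨by tauto, by tauto⟩

theorem vecMulVec_ket {d : ℕ} (i j k l : Fin d) :
    Matrix.vecMulVec (ket i j) (star (ket k l)) = Matrix.single (i, j) (k, l) (1 : ℂ) := by
  rw [Matrix.single_eq_single_vecMulVec_single]
  congr 1
  ext p
  simp [ket, Pi.single_apply, apply_ite]

theorem partialTranspose_sigma_self {d : ℕ} (i : Fin d) :
    partialTranspose (sigma i i) = Matrix.single (i, i) (i, i) 1 := by
  rw [sigma, if_pos rfl, outer, vecMulVec_ket, partialTranspose_single]

theorem partialTranspose_add {d : ℕ} (X Y : Op d) :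
    partialTranspose (X + Y) = partialTranspose X + partialTranspose Y := rfl

theorem partialTranspose_sub {d : ℕ} (X Y : Op d) :
    partialTranspose (X - Y) = partialTranspose X - partialTranspose Y := rfl

theorem partialTranspose_smul {d : ℕ} (c : ℂ) (X : Op d) :
    partialTranspose (c • X) = c • partialTranspose X := rfl

theorem partialTranspose_sigma_of_ne {d : ℕ} {i j : Fin d} (h : i ≠ j) :
    partialTranspose (sigma i j) = (1 / 2 : ℂ) • (Matrix.single (i, j) (i, j) 1
      + Matrix.single (j, j) (i, i) 1
      + (Matrix.single (i, i) (j, j) 1 + Matrix.single (j, i) (j, i) 1)) := by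
  rw [sigma, if_neg h, outer, star_add, Matrix.vecMulVec_add, Matrix.add_vecMulVec,
    Matrix.add_vecMulVec]
  simp only [vecMulVec_ket, partialTranspose_smul, partialTranspose_add, partialTranspose_single]

theorem partialTranspose_alpha {d : ℕ} (i j : Fin d) :
    partialTranspose (alpha i j) = (1 / 2 : ℂ) • (Matrix.single (i, j) (i, j) 1
      - Matrix.single (j, j) (i, i) 1
      - (Matrix.single (i, i) (j, j) 1 - Matrix.single (j, i) (j, i) 1)) := by
  rw [alpha, outer, star_sub, Matrix.vecMulVec_sub, Matrix.sub_vecMulVec, Matrix.sub_vecMulVec]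
  simp only [vecMulVec_ket, partialTranspose_smul, partialTranspose_sub, partialTranspose_single]

theorem isHermitian_partialTranspose {d : ℕ} {X : Op d} (h : X.IsHermitian) :
    (partialTranspose X).IsHermitian := by
  ext p q
  exact h.apply _ _

theorem isHermitian_half_smul_outer {d : ℕ} (v : Fin d × Fin d → ℂ) :
    ((1 / 2 : ℂ) • outer v).IsHermitian := by
  refine Matrix.IsHermitian.smul ?_ ?_
  · exact (Matrix.posSemidef_vecMulVec_self_star v).isHermitian
  · simp [isSelfAdjoint_iff]

theorem isHermitian_sigma {d : ℕ} (i j : Fin d) : (sigma i j).IsHermitian := by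
  unfold sigma
  split_ifs
  · exact (Matrix.posSemidef_vecMulVec_self_star _).isHermitian
  · exact isHermitian_half_smul_outer _

theorem isHermitian_pencil {d : ℕ} (v : Vars d) : (pencil v).IsHermitian := by
  have hr (r : ℝ) : IsSelfAdjoint (r : ℂ) := Complex.conj_ofReal r
  refine Matrix.IsHermitian.add ?_ ?_
  · exact isSelfAdjoint_sum _ fun p _ =>
      (isHermitian_partialTranspose (isHermitian_sigma _ _)).smul (hr _)
  · exact isSelfAdjoint_sum _ fun p _ =>
      (isHermitian_partialTranspose (isHermitian_half_smul_outer _)).smul (hr _)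

theorem dotProduct_single_mulVec {ι : Type*} [Fintype ι] [DecidableEq ι] (x : ι → ℂ) (a b : ι) :
    star x ⬝ᵥ (Matrix.single a b (1 : ℂ)).mulVec x = star (x a) * x b := by
  rw [Matrix.single_mulVec]
  simp [dotProduct, Function.update_apply]

/-- The quadratic form of the block of the pencil on the span of the vectors `|ii⟩`. -/
def form {d : ℕ} (v : Vars d) (x : Fin d → ℝ) : ℝ :=
  ∑ i, v.1 (diagIdx i) * (x i * x i) +
    ∑ p : AltIdx d, (v.1 (altToSym p) - v.2 p) * (x p.1.1 * x p.1.2)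

/-- The partial transpose moves the coherence `|ij⟩⟨ji|` to `|ii⟩⟨jj|`, which gives the block
structure. The block on the `|ii⟩` is real symmetric, so real and imaginary parts of `x` contribute
separately. -/
theorem dotProduct_pencil_mulVec {d : ℕ} (v : Vars d) (x : Fin d × Fin d → ℂ) :
    star x ⬝ᵥ (pencil v).mulVec x =
      ((form v (fun i => (x (i, i)).re) + form v (fun i => (x (i, i)).im) +
        ∑ p : AltIdx d, (v.1 (altToSym p) + v.2 p) / 2 *
          (Complex.normSq (x p.1) + Complex.normSq (x p.1.swap)) : ℝ) : ℂ) := by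
  have hS (y : Fin d × Fin d → ℂ) (a b : Fin d × Fin d) :=
    dotProduct_single_mulVec y a b
  rw [pencil, sum_symIdx, Matrix.add_mulVec, Matrix.add_mulVec]
  simp only [Matrix.sum_mulVec, dotProduct_add, dotProduct_sum, Matrix.smul_mulVec,
    dotProduct_smul, smul_eq_mul]
  have h1 (i : Fin d) : (v.1 (diagIdx i) : ℂ) *
      (star x ⬝ᵥ (partialTranspose (sigma i i)).mulVec x) =
      ((v.1 (diagIdx i) * ((x (i, i)).re * (x (i, i)).re) +
        v.1 (diagIdx i) * ((x (i, i)).im * (x (i, i)).im) : ℝ) : ℂ) := by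
    rw [partialTranspose_sigma_self, hS, Complex.star_def, ← Complex.normSq_eq_conj_mul_self,
      Complex.normSq_apply, ← mul_add]
    push_cast
    rfl
  have h2 (p : AltIdx d) : (v.1 (altToSym p) : ℂ) *
        (star x ⬝ᵥ (partialTranspose (sigma p.1.1 p.1.2)).mulVec x) +
      (v.2 p : ℂ) * (star x ⬝ᵥ (partialTranspose (alpha p.1.1 p.1.2)).mulVec x) =
      (((v.1 (altToSym p) - v.2 p) * ((x (p.1.1, p.1.1)).re * (x (p.1.2, p.1.2)).re) +
        (v.1 (altToSym p) - v.2 p) * ((x (p.1.1, p.1.1)).im * (x (p.1.2, p.1.2)).im) +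
        (v.1 (altToSym p) + v.2 p) / 2 *
          (Complex.normSq (x p.1) + Complex.normSq (x p.1.swap)) : ℝ) : ℂ) := by
    rw [partialTranspose_sigma_of_ne (ne_of_gt p.2), partialTranspose_alpha]
    simp only [Matrix.smul_mulVec, Matrix.add_mulVec, Matrix.sub_mulVec, dotProduct_smul,
      dotProduct_add, dotProduct_sub, hS, smul_eq_mul]
    have hp : x p.1 = x (p.1.1, p.1.2) := rfl
    have hq : x p.1.swap = x (p.1.2, p.1.1) := rfl
    rw [hp, hq]
    apply Complex.ext <;> simp [Complex.normSq_apply] <;> ring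
  simp only [h1]
  rw [add_assoc, ← Finset.sum_add_distrib, Finset.sum_congr rfl fun p _ => h2 p]
  simp only [← Complex.ofReal_sum, ← Complex.ofReal_add]
  congr 1
  simp only [form, Finset.sum_add_distrib]
  ring

/-- Positivity of the pencil, in terms of real quadratic forms. -/
theorem posSemidef_pencil_iff {d : ℕ} (v : Vars d) :
    (pencil v).PosSemidef ↔
      (∀ p : AltIdx d, 0 ≤ v.1 (altToSym p) + v.2 p) ∧ ∀ x, 0 ≤ form v x := by
  constructor
  · intro h
    have h' (x : Fin d × Fin d → ℂ) := h.dotProduct_mulVec_nonneg x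
    simp only [dotProduct_pencil_mulVec, Complex.zero_le_real] at h'
    refine ⟨fun p => ?_, fun x => ?_⟩
    · have h0 : ∀ i, (Pi.single p.1 (1 : ℂ) : Fin d × Fin d → ℂ) (i, i) = 0 := fun i => by
        rw [Pi.single_apply, if_neg]
        intro hp
        have := p.2
        rw [← hp] at this
        exact lt_irrefl _ this
      have := h' (Pi.single p.1 1)
      simp only [h0] at this
      rw [Finset.sum_eq_single p] at this
      · have hsw : p.1.swap ≠ p.1 := fun hp => p.2.ne (congrArg Prod.fst hp)
        simp [form, hsw] at this
        linarith
      · intro q _ hq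
        have h1 : q.1 ≠ p.1 := fun h => hq (Subtype.ext h)
        have h2 : q.1.swap ≠ p.1 := fun h => by
          have := p.2
          rw [← h] at this
          exact lt_asymm this q.2
        simp [h1, h2]
      · simp
    · have := h' fun q => if q.1 = q.2 then (x q.1 : ℂ) else 0
      rw [Finset.sum_eq_zero] at this
      · simpa [form] using this
      · intro p _
        simp [(ne_of_lt p.2).symm, ne_of_lt p.2]
  · rintro ⟨h1, h2⟩
    refine Matrix.PosSemidef.of_dotProduct_mulVec_nonneg (isHermitian_pencil v) fun x => ?_
    rw [dotProduct_pencil_mulVec, Complex.zero_le_real]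
    refine add_nonneg (add_nonneg (h2 _) (h2 _)) (Finset.sum_nonneg fun p _ => ?_)
    exact mul_nonneg (by linarith [h1 p])
      (add_nonneg (Complex.normSq_nonneg _) (Complex.normSq_nonneg _))

/-! ### The cone of variables with positive pencil -/

/-- The cone of the families of variables whose pencil is positive semidefinite. -/
def cone (d : ℕ) : Set (Vars d) := {v | (pencil v).PosSemidef}

theorem mem_cone_iff {d : ℕ} {v : Vars d} : v ∈ cone d ↔
    (∀ p : AltIdx d, 0 ≤ v.1 (altToSym p) + v.2 p) ∧ ∀ x, 0 ≤ form v x :=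
  posSemidef_pencil_iff v

theorem form_add {d : ℕ} (v w : Vars d) (x : Fin d → ℝ) :
    form (v + w) x = form v x + form w x := by
  simp only [form, Prod.fst_add, Prod.snd_add, Pi.add_apply, add_mul, sub_mul,
    Finset.sum_add_distrib, Finset.sum_sub_distrib]
  ring

theorem form_smul {d : ℕ} (t : ℝ) (v : Vars d) (x : Fin d → ℝ) :
    form (t • v) x = t * form v x := by
  simp only [form, Prod.smul_fst, Prod.smul_snd, Pi.smul_apply, smul_eq_mul, mul_assoc, mul_add,
    Finset.mul_sum, ← mul_sub]

theorem add_mem_cone {d : ℕ} {v w : Vars d} (hv : v ∈ cone d) (hw : w ∈ cone d) :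
    v + w ∈ cone d := by
  rw [mem_cone_iff] at *
  refine ⟨fun p => ?_, fun x => ?_⟩
  · have := add_nonneg (hv.1 p) (hw.1 p)
    simp only [Prod.fst_add, Prod.snd_add, Pi.add_apply]
    linarith
  · rw [form_add]
    exact add_nonneg (hv.2 x) (hw.2 x)

theorem smul_mem_cone {d : ℕ} {t : ℝ} (ht : 0 ≤ t) {v : Vars d} (hv : v ∈ cone d) :
    t • v ∈ cone d := by
  rw [mem_cone_iff] at *
  refine ⟨fun p => ?_, fun x => ?_⟩
  · simpa [mul_add] using mul_nonneg ht (hv.1 p)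
  · rw [form_smul]
    exact mul_nonneg ht (hv.2 x)

theorem zero_mem_cone (d : ℕ) : (0 : Vars d) ∈ cone d := by
  rw [mem_cone_iff]
  simp [form]

theorem isClosed_cone (d : ℕ) : IsClosed (cone d) := by
  simp only [cone, form, Set.ofPred_and, Set.ofPred_forall, posSemidef_pencil_iff]
  refine IsClosed.inter (isClosed_iInter fun p => ?_) (isClosed_iInter fun x => ?_) <;>
  exact isClosed_le (by fun_prop) (by fun_prop)

/-- Elements of the cone that are bounded above are bounded below. -/
theorem neg_le_of_mem_cone {d : ℕ} {w : Vars d} (hw : w ∈ cone d) {b : ℝ} (hb : 0 ≤ b)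
    (h1 : ∀ p, w.1 p ≤ b) :
    (∀ p, -b ≤ w.1 p) ∧ ∀ p, -b ≤ w.2 p := by
  rw [mem_cone_iff] at hw
  have hdiag (i : Fin d) : 0 ≤ w.1 (diagIdx i) := by
    have := hw.2 (Pi.single i 1)
    rw [form, Finset.sum_eq_zero (s := (Finset.univ : Finset (AltIdx d)))] at this
    · simpa [Pi.single_apply] using this
    · intro p _
      have := p.2.ne
      by_cases h : p.1.1 = i
      · have : p.1.2 ≠ i := fun h' => this (h'.trans h.symm)
        simp [this]
      · simp [h]
  -- The cases `e = ±1` give `|s_ij - a_ij| ≤ s_ii + s_jj ≤ 2b`; together with `s_ij + a_ij ≥ 0`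
  -- this bounds both variables below by `-b`.
  have hoff (p : AltIdx d) (e : ℝ) (he : e * e = 1) :
      0 ≤ w.1 (diagIdx p.1.1) + w.1 (diagIdx p.1.2) + e * (w.1 (altToSym p) - w.2 p) := by
    have hne := p.2.ne
    have := hw.2 (Pi.single p.1.1 1 + Pi.single p.1.2 e)
    rw [form, Finset.sum_eq_single p (s := (Finset.univ : Finset (AltIdx d))),
      Fintype.sum_eq_add p.1.1 p.1.2 hne.symm] at this
    · simpa [hne, hne.symm, he, mul_comm] using this
    · rintro i ⟨h1, h2⟩
      simp [h1, h2]
    · intro q _ hq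
      have h1 := q.2
      have h2 := p.2
      by_cases ha : q.1.1 = p.1.1 <;> by_cases hb : q.1.1 = p.1.2 <;>
        by_cases hc : q.1.2 = p.1.1 <;> by_cases hd : q.1.2 = p.1.2
      all_goals first
        | exact absurd (Subtype.ext (Prod.ext ha hd)) hq
        | (exfalso; grind)
        | simp [ha, hb, hc, hd]
    · simp
  have halt (p : AltIdx d) : -b ≤ w.1 (altToSym p) ∧ -b ≤ w.2 p := by
    have e1 := hoff p 1 (by norm_num)
    have e2 := hoff p (-1) (by norm_num)
    have e3 := hw.1 p
    have e4 := h1 (diagIdx p.1.1)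
    have e5 := h1 (diagIdx p.1.2)
    constructor <;> linarith
  refine ⟨fun p => ?_, fun p => (halt p).2⟩
  obtain ⟨⟨i, j⟩, hp⟩ := p
  rcases lt_or_eq_of_le hp with h | h
  · exact (halt ⟨(i, j), h⟩).1
  · simp only at h
    subst h
    linarith [hdiag j]

/-- The symmetric matrix of the quadratic form `form v`. -/
noncomputable def formMatrix {d : ℕ} (v : Vars d) : Matrix (Fin d) (Fin d) ℝ :=
  Matrix.of fun i j =>
    if h : j < i then (v.1 (altToSym ⟨(i, j), h⟩) - v.2 ⟨(i, j), h⟩) / 2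
    else if h : i < j then (v.1 (altToSym ⟨(j, i), h⟩) - v.2 ⟨(j, i), h⟩) / 2
    else v.1 (diagIdx i)

theorem formMatrix_self {d : ℕ} (v : Vars d) (i : Fin d) :
    formMatrix v i i = v.1 (diagIdx i) := by
  simp [formMatrix]

theorem formMatrix_alt {d : ℕ} (v : Vars d) (p : AltIdx d) :
    formMatrix v p.1.1 p.1.2 = (v.1 (altToSym p) - v.2 p) / 2 := by
  have := p.2
  simp [formMatrix, this]

theorem formMatrix_comm {d : ℕ} (v : Vars d) (i j : Fin d) :
    formMatrix v i j = formMatrix v j i := by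
  rcases lt_trichotomy i j with h | h | h
  · simp [formMatrix, h, h.not_gt]
  · rw [h]
  · simp [formMatrix, h, h.not_gt]

theorem sum_formMatrix {d : ℕ} (v : Vars d) (x : Fin d → ℝ) :
    ∑ i, ∑ j, formMatrix v i j * (x i * x j) = form v x := by
  rw [sum_sum_eq_diag_add_alt]
  simp only [formMatrix_comm v (Prod.snd _) (Prod.fst _), formMatrix_self, formMatrix_alt, form]
  congr 1
  refine Finset.sum_congr rfl fun p _ => ?_
  ring

theorem posSemidef_formMatrix {d : ℕ} {v : Vars d} (hv : v ∈ cone d) :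
    (formMatrix v).PosSemidef := by
  refine Matrix.PosSemidef.of_dotProduct_mulVec_nonneg ?_ fun x => ?_
  · ext i j
    exact formMatrix_comm v j i
  · refine ((mem_cone_iff.1 hv).2 x).trans_eq ?_
    rw [← sum_formMatrix]
    simp only [dotProduct, Matrix.mulVec, Finset.mul_sum, Pi.star_apply, star_trivial]
    refine Finset.sum_congr rfl fun i _ => Finset.sum_congr rfl fun j _ => ?_
    ring

/-- Rests on `2(ss' + aa') = (s - a)(s' - a') + (s + a)(s' + a')`; each off-diagonal entry occurs
twice in the trace pairing. -/
theorem dot_eq_sum_formMatrix {d : ℕ} (v w : Vars d) :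
    dot v w = ∑ i, ∑ j, formMatrix v i j * formMatrix w i j +
      ∑ p : AltIdx d, (v.1 (altToSym p) + v.2 p) * (w.1 (altToSym p) + w.2 p) / 2 := by
  rw [sum_sum_eq_diag_add_alt]
  simp only [formMatrix_comm _ (Prod.snd _) (Prod.fst _), formMatrix_self, formMatrix_alt, dot,
    sum_symIdx, add_assoc, ← Finset.sum_add_distrib]
  congr 1
  refine Finset.sum_congr rfl fun p _ => ?_
  ring

/-- The cone is contained in its dual. -/
theorem dot_nonneg_of_mem_cone {d : ℕ} {v w : Vars d} (hv : v ∈ cone d) (hw : w ∈ cone d) :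
    0 ≤ dot v w := by
  rw [dot_eq_sum_formMatrix]
  refine add_nonneg ?_ (Finset.sum_nonneg fun p _ => ?_)
  -- Schur product theorem: the trace pairing is the quadratic form of the Hadamard product at the
  -- all-ones vector.
  · have := ((posSemidef_formMatrix hv).hadamard
      (posSemidef_formMatrix hw)).dotProduct_mulVec_nonneg 1
    simpa [dotProduct, Matrix.mulVec] using this
  · exact div_nonneg (mul_nonneg ((mem_cone_iff.1 hv).1 p) ((mem_cone_iff.1 hw).1 p)) two_pos.le

/-- The cone contains its dual. -/
theorem mem_cone_of_dot_nonneg {d : ℕ} {v : Vars d} (hv : ∀ w ∈ cone d, 0 ≤ dot v w) :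
    v ∈ cone d := by
  refine mem_cone_iff.2 ⟨fun p => ?_, fun x => ?_⟩
  -- This test point has zero form and pairs with `v` to `s_ij + a_ij`.
  · have := hv (Pi.single (altToSym p) 1, Pi.single p 1) <| by
      refine mem_cone_iff.2 ⟨fun q => ?_, fun x => ?_⟩
      · simp only [Pi.single_apply]
        positivity
      · have h1 (i : Fin d) : diagIdx i ≠ altToSym p := fun h => by
          have h' := congrArg Subtype.val h
          have := p.2
          rw [← h'] at this
          exact lt_irrefl _ this
        have h2 (q : AltIdx d) : altToSym q = altToSym p ↔ q = p := by
          simp [Subtype.ext_iff]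
        simp [form, Pi.single_apply, h1, h2]
    simpa [dot, Pi.single_apply] using this
  -- This test point encodes the rank-one matrix `x xᵀ`: taking `a = -s` makes `s + a` vanish, and
  -- the pairing with `v` is `form v x`.
  · have := hv (fun p => x p.1.1 * x p.1.2, fun p => -(x p.1.1 * x p.1.2)) <| by
      refine mem_cone_iff.2 ⟨fun q => by simp, fun y => ?_⟩
      have : form (fun p : SymIdx d => x p.1.1 * x p.1.2,
          fun p : AltIdx d => -(x p.1.1 * x p.1.2)) y = (∑ i, x i * y i) * ∑ j, x j * y j := by
        rw [Finset.sum_mul_sum, sum_sum_eq_diag_add_alt, form]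
        congr 1
        · exact Finset.sum_congr rfl fun i _ => by ring
        · exact Finset.sum_congr rfl fun i _ => by ring
      rw [this]
      exact mul_self_nonneg _
    convert this using 1
    rw [dot, sum_symIdx, form, add_assoc, ← Finset.sum_add_distrib]
    congr 1
    exact Finset.sum_congr rfl fun i _ => by ring

/-! ### Duality -/

/-- The lower bounds of the variables of the primal program. -/
noncomputable def lowerBound {d : ℕ} (K : ℕ) (lam : Fin d → ℝ) : Vars d :=
  (fun p => Real.sqrt (lam p.1.1 * lam p.1.2) / ((K : ℝ) + 1),
    fun p => Real.sqrt (lam p.1.1 * lam p.1.2) / ((K : ℝ) - 1))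

theorem mem_primalFeasible_iff {d : ℕ} {K : ℕ} {lam : Fin d → ℝ} {v : Vars d} :
    v ∈ primalFeasible K lam ↔ lowerBound K lam ≤ v ∧ v ∈ cone d :=
  and_assoc.symm

theorem mem_dualFeasible_iff {d : ℕ} {v : Vars d} :
    v ∈ dualFeasible d ↔ v ≤ 1 ∧ v ∈ cone d :=
  and_assoc.symm

/-- With `S = ∑ √λ_i`, one has `2^{S_{1/2}} = S²`, and the sum of `√(λ_i λ_j)` over `i > j` is `(S²
- 1)/2`. -/
theorem dot_one_lowerBound {d K : ℕ} (hK : 2 ≤ K) {lam : Fin d → ℝ} (hlam : ∀ i, 0 ≤ lam i)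
    (hsum : ∑ i, lam i = 1) :
    dot 1 (lowerBound K lam) =
      ((K : ℝ) * (2 : ℝ) ^ renyiEntropy (1 / 2) lam - 1) / ((K : ℝ) ^ 2 - 1) := by
  have hK' : (2 : ℝ) ≤ K := by exact_mod_cast hK
  have hsq : ∑ i, ∑ j, √(lam i * lam j) = (∑ i, √(lam i)) ^ 2 := by
    simp only [Real.sqrt_mul (hlam _), sq, Finset.sum_mul_sum]
  have hself : ∑ i, √(lam i * lam i) = 1 := by
    simp only [Real.sqrt_mul_self (hlam _), hsum]
  have hpos : 0 < ∑ i, √(lam i) := by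
    refine (Finset.sum_nonneg fun i _ => Real.sqrt_nonneg _).lt_of_ne' fun h => ?_
    have h0 := (Finset.sum_eq_zero_iff_of_nonneg fun i _ => Real.sqrt_nonneg _).1 h
    have : ∑ i, lam i = 0 := Finset.sum_eq_zero fun i hi =>
      (Real.sqrt_eq_zero (hlam i)).1 (h0 i hi)
    linarith
  have hent : (2 : ℝ) ^ renyiEntropy (1 / 2) lam = (∑ i, √(lam i)) ^ 2 := by
    have h2 : (1 : ℝ) / (1 - 1 / 2) = 2 := by norm_num
    simp only [renyiEntropy, ← Real.sqrt_eq_rpow, h2]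
    rw [mul_comm, Real.rpow_mul two_pos.le, Real.rpow_logb two_pos (by norm_num) hpos,
      Real.rpow_two]
  have halt := sum_sum_eq_diag_add_alt fun i j => √(lam i * lam j)
  simp only [mul_comm (lam (Prod.snd _)), hsq, hself, ← two_mul, ← Finset.mul_sum] at halt
  rw [hent, halt]
  simp only [dot, lowerBound, Prod.fst_one, Prod.snd_one, Pi.one_apply, one_mul,
    ← Finset.sum_div, sum_symIdx, hself]
  have h1 : (K : ℝ) + 1 ≠ 0 := by linarith
  have h2 : (K : ℝ) - 1 ≠ 0 := by linarith
  have h3 : (K : ℝ) ^ 2 - 1 ≠ 0 := by nlinarith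
  field_simp
  ring

theorem dualObjective_eq {d K : ℕ} (hK : 2 ≤ K) {lam : Fin d → ℝ} (hlam : ∀ i, 0 ≤ lam i)
    (hsum : ∑ i, lam i = 1) (w : Vars d) :
    dualObjective K lam w = dot 1 (lowerBound K lam) - dot (lowerBound K lam) w := by
  rw [dot_one_lowerBound hK hlam hsum, dualObjective]
  simp only [dot, lowerBound, mul_div_right_comm, mul_comm]

/-- Setting all variables equal to a large constant makes the form diagonal. -/
theorem exists_mem_cone_ge {d : ℕ} (c : Vars d) : ∃ v ∈ cone d, c ≤ v := by
  obtain ⟨b, hb⟩ := (Set.finite_range c.1).bddAbove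
  obtain ⟨b', hb'⟩ := (Set.finite_range c.2).bddAbove
  let m := max (max b b') 0
  refine ⟨(fun _ => m, fun _ => m), mem_cone_iff.2 ⟨fun p => ?_, fun x => ?_⟩,
    fun p => ?_, fun p => ?_⟩
  · exact add_nonneg (le_max_right _ _) (le_max_right _ _)
  · simp only [form, sub_self, zero_mul, Finset.sum_const_zero, add_zero]
    exact Finset.sum_nonneg fun i _ => mul_nonneg (le_max_right _ _) (mul_self_nonneg _)
  · exact (hb ⟨p, rfl⟩).trans ((le_max_left _ _).trans (le_max_left _ _))
  · exact (hb' ⟨p, rfl⟩).trans ((le_max_right _ _).trans (le_max_left _ _))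

theorem isCompact_sublevel {d : ℕ} (c : Vars d) (m : ℝ) :
    IsCompact {v : Vars d | (c ≤ v ∧ v ∈ cone d) ∧ dot 1 v ≤ m} := by
  have hcl : IsClosed {v : Vars d | (c ≤ v ∧ v ∈ cone d) ∧ dot 1 v ≤ m} :=
    ((isClosed_le continuous_const continuous_id).inter (isClosed_cone d)).inter
      (isClosed_le (continuous_dot 1) continuous_const)
  let r := m - dot 1 c
  refine (isCompact_Icc (a := c) (b := (fun p => c.1 p + r, fun p => c.2 p + r))).of_isClosed_subset
    hcl ?_
  rintro v ⟨⟨hcv, -⟩, hm⟩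
  have h0 : dot 1 (v - c) ≤ r := by
    rw [dot_sub_right]
    exact sub_le_sub_right hm _
  have h1 (p) : 0 ≤ v.1 p - c.1 p := sub_nonneg.2 (hcv.1 p)
  have h2 (p) : 0 ≤ v.2 p - c.2 p := sub_nonneg.2 (hcv.2 p)
  have hs1 : 0 ≤ ∑ p, (v.1 p - c.1 p) := Finset.sum_nonneg fun p _ => h1 p
  have hs2 : 0 ≤ ∑ p, (v.2 p - c.2 p) := Finset.sum_nonneg fun p _ => h2 p
  have h0' : ∑ p, (v.1 p - c.1 p) + ∑ p, (v.2 p - c.2 p) ≤ r := by simpa [dot] using h0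
  refine ⟨hcv, fun p => ?_, fun p => ?_⟩
  · have := Finset.single_le_sum (fun p _ => h1 p) (Finset.mem_univ p)
    change v.1 p ≤ c.1 p + r
    linarith
  · have := Finset.single_le_sum (fun p _ => h2 p) (Finset.mem_univ p)
    change v.2 p ≤ c.2 p + r
    linarith

/-- The primal minimum is attained. -/
theorem exists_isMinOn_dot_one {d : ℕ} (c : Vars d) :
    ∃ v, (c ≤ v ∧ v ∈ cone d) ∧ ∀ w, c ≤ w → w ∈ cone d → dot 1 v ≤ dot 1 w := by
  obtain ⟨v₀, hv₀, hcv₀⟩ := exists_mem_cone_ge c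
  obtain ⟨v, hv, hmin⟩ := (isCompact_sublevel c (dot 1 v₀)).exists_isMinOn
    ⟨v₀, ⟨hcv₀, hv₀⟩, le_rfl⟩ (continuous_dot 1).continuousOn
  refine ⟨v, hv.1, fun w hcw hw => ?_⟩
  rcases le_total (dot 1 w) (dot 1 v₀) with h | h
  · exact hmin (a := w) ⟨⟨hcw, hw⟩, h⟩
  · exact hv.2.trans h

/-- The upper bounds `u` and values `r` that are reached by elements of the cone. -/
def valueCone {d : ℕ} (c : Vars d) : Set (Vars d × ℝ) :=
  {q | ∃ w ∈ cone d, w ≤ q.1 ∧ dot c w ≤ q.2}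

theorem convex_valueCone {d : ℕ} (c : Vars d) : Convex ℝ (valueCone c) := by
  rintro q ⟨w, hw, hwq, hc⟩ q' ⟨w', hw', hwq', hc'⟩ s t hs ht -
  refine ⟨s • w + t • w', add_mem_cone (smul_mem_cone hs hw) (smul_mem_cone ht hw'),
    add_le_add (smul_le_smul_of_nonneg_left hwq hs) (smul_le_smul_of_nonneg_left hwq' ht), ?_⟩
  rw [dot_add_right, dot_smul_right, dot_smul_right]
  exact add_le_add (mul_le_mul_of_nonneg_left hc hs) (mul_le_mul_of_nonneg_left hc' ht)

theorem smul_mem_valueCone {d : ℕ} {c : Vars d} {q : Vars d × ℝ} (hq : q ∈ valueCone c) {t : ℝ}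
    (ht : 0 ≤ t) : t • q ∈ valueCone c := by
  obtain ⟨w, hw, hwq, hc⟩ := hq
  refine ⟨t • w, smul_mem_cone ht hw, smul_le_smul_of_nonneg_left hwq ht, ?_⟩
  rw [dot_smul_right]
  exact mul_le_mul_of_nonneg_left hc ht

/-- Along a convergent sequence the upper bounds stay bounded, so by `neg_le_of_mem_cone` the
witnesses lie in a fixed box and subconverge. -/
theorem isClosed_valueCone {d : ℕ} (c : Vars d) : IsClosed (valueCone c) := by
  refine IsSeqClosed.isClosed fun q q₀ hq hlim => ?_
  choose w hw hwq hc using hq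
  obtain ⟨b, hb⟩ := (Metric.isBounded_range_of_tendsto q hlim).exists_norm_le
  have hqb (n) : ‖(q n).1‖ ≤ b := (norm_fst_le _).trans (hb _ ⟨n, rfl⟩)
  have hb0 : 0 ≤ b := (norm_nonneg _).trans (hqb 0)
  have h1 (n) (p) : (w n).1 p ≤ b := ((hwq n).1 p).trans <| (Real.le_norm_self _).trans <|
    (norm_le_pi_norm _ p).trans <| (norm_fst_le _).trans (hqb n)
  have h2 (n) (p) : (w n).2 p ≤ b := ((hwq n).2 p).trans <| (Real.le_norm_self _).trans <|
    (norm_le_pi_norm _ p).trans <| (norm_snd_le _).trans (hqb n)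
  have h3 (n) := neg_le_of_mem_cone (hw n) hb0 (h1 n)
  have hmem (n) : w n ∈ Set.Icc ((fun _ => -b, fun _ => -b) : Vars d) (fun _ => b, fun _ => b) :=
    ⟨⟨(h3 n).1, (h3 n).2⟩, ⟨h1 n, h2 n⟩⟩
  obtain ⟨w₀, -, φ, hφ, hw₀⟩ := isCompact_Icc.tendsto_subseq hmem
  have hq₀ := hlim.comp hφ.tendsto_atTop
  refine ⟨w₀, (isClosed_cone d).mem_of_tendsto hw₀ (.of_forall fun n => hw (φ n)), ?_, ?_⟩
  · exact le_of_tendsto_of_tendsto' hw₀ ((continuous_fst.tendsto _).comp hq₀) fun n => hwq (φ n)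
  · exact le_of_tendsto_of_tendsto' (((continuous_dot c).tendsto _).comp hw₀)
      ((continuous_snd.tendsto _).comp hq₀) fun n => hc (φ n)

/-- Separation: either the dual program reaches the value `m`, or the primal one goes below. -/
theorem exists_dual_or_primal {d : ℕ} (c : Vars d) (m : ℝ) :
    (∃ w ∈ cone d, w ≤ 1 ∧ m ≤ dot 1 c - dot c w) ∨
      ∃ v ∈ cone d, c ≤ v ∧ dot 1 v < m := by
  by_cases hmem : ((1 : Vars d), dot 1 c - m) ∈ valueCone c
  · obtain ⟨w, hw, h1, h2⟩ := hmem
    exact Or.inl ⟨w, hw, h1, by linarith [show dot c w ≤ dot 1 c - m from h2]⟩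
  right
  obtain ⟨f, u, hf, hfu⟩ :=
    geometric_hahn_banach_closed_point (convex_valueCone c) (isClosed_valueCone c) hmem
  have hu : 0 < u := by
    simpa using hf 0 ⟨0, zero_mem_cone d, le_rfl, by simp [dot]⟩
  -- A linear functional bounded above on a cone is nonpositive there.
  have hnonpos (q) (hq : q ∈ valueCone c) : f q ≤ 0 := by
    by_contra! hpos
    have := hf _ (smul_mem_valueCone hq (div_pos hu hpos).le)
    rw [map_smul, smul_eq_mul, div_mul_cancel₀ _ hpos.ne'] at this
    exact lt_irrefl _ this
  obtain ⟨y, hy⟩ := exists_dot_eq (-(f.toLinearMap ∘ₗ LinearMap.inl ℝ (Vars d) ℝ))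
  set t : ℝ := -f (0, 1) with ht_def
  have hfy (v : Vars d) (r : ℝ) : -f (v, r) = dot y v + t * r := by
    rw [← hy v, show (v, r) = (v, (0 : ℝ)) + r • ((0 : Vars d), (1 : ℝ)) by simp, map_add,
      map_smul]
    simp [ht_def]
    ring
  have hge (v : Vars d) (r : ℝ) (h : (v, r) ∈ valueCone c) : 0 ≤ dot y v + t * r := by
    rw [← hfy]
    linarith [hnonpos _ h]
  have hlt : dot y 1 + t * (dot 1 c - m) < 0 := by
    rw [← hfy]
    linarith
  have ht : 0 ≤ t := by
    simpa [dot] using hge 0 1 ⟨0, zero_mem_cone d, le_rfl, by simp [dot]⟩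
  -- Raising one upper bound keeps the witness `w = 0` valid.
  have hy0 : 0 ≤ y := by
    refine ⟨fun p => ?_, fun p => ?_⟩
    · have := hge (Pi.single p 1, 0) 0 ⟨0, zero_mem_cone d, ⟨?_, le_rfl⟩, by simp [dot]⟩
      · simpa [dot, Pi.single_apply] using this
      · exact Pi.single_nonneg.2 zero_le_one
    · have := hge (0, Pi.single p 1) 0 ⟨0, zero_mem_cone d, ⟨le_rfl, ?_⟩, by simp [dot]⟩
      · simpa [dot, Pi.single_apply] using this
      · exact Pi.single_nonneg.2 zero_le_one
  have hy1 : 0 ≤ dot y 1 := dot_nonneg hy0 ⟨fun _ => zero_le_one, fun _ => zero_le_one⟩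
  -- The separating functional is not vertical: `t = 0` would force `y·1 < 0`.
  have htpos : 0 < t := by
    refine ht.lt_of_ne fun h => ?_
    rw [← h] at hlt
    linarith
  -- Testing on the points `(w, c·w)` puts `y + t c` in the dual cone; dividing by `t` yields a
  -- primal point of value `1·c + (y·1)/t < m`.
  have hcone : y + t • c ∈ cone d := mem_cone_of_dot_nonneg fun w hw => by
    rw [dot_add_left, dot_smul_left]
    exact hge w _ ⟨w, hw, le_rfl, le_rfl⟩
  refine ⟨t⁻¹ • (y + t • c), smul_mem_cone (inv_nonneg.2 ht) hcone, ?_, ?_⟩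
  · rw [smul_add, inv_smul_smul₀ htpos.ne']
    exact le_add_of_nonneg_left (smul_nonneg (inv_nonneg.2 ht) hy0)
  · rw [dot_smul_right, dot_add_right, dot_smul_right, inv_mul_lt_iff₀ htpos, dot_comm 1 y]
    linarith

/-- Weak duality. -/
theorem dot_sub_dot_le_dot {d : ℕ} {c v w : Vars d} (hcv : c ≤ v) (hv : v ∈ cone d)
    (hw1 : w ≤ 1) (hw : w ∈ cone d) : dot 1 c - dot c w ≤ dot 1 v := by
  have h1 := dot_nonneg (sub_nonneg.2 hw1) (sub_nonneg.2 hcv)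
  have h2 := dot_nonneg_of_mem_cone hv hw
  rw [dot_sub_left, dot_sub_right, dot_sub_right, dot_comm w v, dot_comm w c] at h1
  linarith

end PPTDual

theorem mainTheorem6 (d K : ℕ) (hK : 2 ≤ K) (lam : Fin d → ℝ)
    (hlam : ∀ i, 0 ≤ lam i) (hsum : ∑ i, lam i = 1) :
    IsLeast (PPTDual.primalObjective '' PPTDual.primalFeasible K lam) (PPTDual.T K lam) ∧
      IsGreatest (PPTDual.dualObjective K lam '' PPTDual.dualFeasible d)
        (PPTDual.T K lam) := by
  open PPTDual in
  obtain ⟨v, ⟨hcv, hv⟩, hmin⟩ := exists_isMinOn_dot_one (lowerBound K lam)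
  have hleast : IsLeast (primalObjective '' primalFeasible K lam) (dot 1 v) := by
    refine ⟨⟨v, mem_primalFeasible_iff.2 ⟨hcv, hv⟩, primalObjective_eq_dot v⟩, ?_⟩
    rintro _ ⟨w, hw, rfl⟩
    rw [mem_primalFeasible_iff] at hw
    rw [primalObjective_eq_dot]
    exact hmin w hw.1 hw.2
  have hT : T K lam = dot 1 v := hleast.csInf_eq
  rw [hT]
  have hle : ∀ w ∈ dualFeasible d, dualObjective K lam w ≤ dot 1 v := fun w hw => by
    rw [mem_dualFeasible_iff] at hw
    rw [dualObjective_eq hK hlam hsum]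
    exact dot_sub_dot_le_dot hcv hv hw.1 hw.2
  refine ⟨hleast, ?_, ?_⟩
  -- At `m` equal to the primal minimum, the second alternative contradicts minimality.
  · rcases exists_dual_or_primal (lowerBound K lam) (dot 1 v) with ⟨w, hw, hw1, h⟩ | ⟨w, hw, hcw, h⟩
    · rw [← dualObjective_eq hK hlam hsum] at h
      have hwR := mem_dualFeasible_iff.2 ⟨hw1, hw⟩
      exact ⟨w, hwR, (hle w hwR).antisymm h⟩
    · exact absurd (hmin w hcw hw) h.not_ge
  · rintro _ ⟨w, hw, rfl⟩
    exact hle w hw
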